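/- Let $K$ be a field of characteristic zero, $G$ an abelian group (written multiplicatively), and $\varepsilon\colon G\times G\to K^\times$ an antisymmetric bicharacter, i.e. $\varepsilon(g,h)\varepsilon(h,g)=1$, $\varepsilon(g,hk)=\varepsilon(g,h)\varepsilon(g,k)$ and $\varepsilon(gh,k)=\varepsilon(g,k)\varepsilon(h,k)$ for all $g,h,k\in G$. A $G$-graded $\varepsilon$-Lie algebra is a graded $K$-vector space $L=\bigoplus_{g\in G}L_g$ with a bilinear map $\langle-,-\rangle\colon L\times L\to L$ such that, for all $g,h,k\in G$ and $x\in L_g$, $y\in L_h$, $z\in L_k$, $$\langle x,y\rangle\in L_{gh},\qquad \langle x,y\rangle=-\varepsilon(g,h)\langle y,x\rangle,$$ $$\varepsilon(k,g)\langle x,\langle y,z\rangle\rangle+\varepsilon(g,h)\langle y,\langle z,x\rangle\rangle+\varepsilon(h,k)\langle z,\langle x,y\rangle\rangle=0.$$ Its universal enveloping algebra is $\mathcal U(L)=\mathcal T(L)/\mathcal J(L)$, where $\mathcal T(L)$ is the tensor algebra of $L$ over $K$ and $\mathcal J(L)$ is the two-sided ideal generated by the elements $x\otimes y-\varepsilon(g,h)\,y\otimes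 x-\langle x,y\rangle$ for all $g,h\in G$, $x\in L_g$, $y\in L_h$. If $L$ is a finite-dimensional $G$-graded $\varepsilon$-Lie algebra, then $\mathcal U(L)$ is a two-sided noetherian ring, i.e. both left noetherian and right noetherian. -/

import Mathlib

/-- An antisymmetric bicharacter `ε : G × G → Kˣ` on an abelian group `G`
(written multiplicatively). -/
structure IsAntisymmBicharacter {K G : Type*} [Field K] [CommGroup G]
    (ε : G → G → Kˣ) : Prop where
  antisymm : ∀ g h, ε g h * ε h g = 1
  map_mul_right : ∀ g h k, ε g (h * k) = ε g h * ε g k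
  map_mul_left : ∀ g h k, ε (g * h) k = ε g k * ε h k

open Classical in
/-- A `G`-graded `ε`-Lie algebra structure (a color Lie algebra structure) on the `K`-vector
space `L`: a grading `L = ⨁ g, L_g` together with a bilinear bracket satisfying the gradation
condition, color symmetry and the color Jacobi identity. -/
structure ColorLieAlgebra (K G L : Type*) [Field K] [CommGroup G] [AddCommGroup L] [Module K L]
    (ε : G → G → Kˣ) where
  /-- The homogeneous component `L_g`. -/
  component : G → Submodule K L
  isInternal : DirectSum.IsInternal component
  /-- The color bracket `⟨x, y⟩`. -/
  bracket : L →ₗ[K] L →ₗ[K] L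
  bracket_mem : ∀ {g h : G} {x y : L}, x ∈ component g → y ∈ component h →
    bracket x y ∈ component (g * h)
  color_symm : ∀ {g h : G} {x y : L}, x ∈ component g → y ∈ component h →
    bracket x y = -((ε g h : K) • bracket y x)
  color_jacobi : ∀ {g h k : G} {x y z : L},
    x ∈ component g → y ∈ component h → z ∈ component k →
    (ε k g : K) • bracket x (bracket y z) + (ε g h : K) • bracket y (bracket z x)
      + (ε h k : K) • bracket z (bracket x y) = 0

namespace ColorLieAlgebra

variable {K G L : Type*} [Field K] [CommGroup G] [AddCommGroup L] [Module K L]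
  {ε : G → G → Kˣ}

/-- The elements `x ⊗ y - ε(g, h) y ⊗ x - ⟨x, y⟩` of the tensor algebra of `L`, for homogeneous
`x` of degree `g` and `y` of degree `h`. -/
def relators (A : ColorLieAlgebra K G L ε) : Set (TensorAlgebra K L) :=
  {t | ∃ (g h : G) (x y : L), x ∈ A.component g ∧ y ∈ A.component h ∧
    t = TensorAlgebra.ι K x * TensorAlgebra.ι K y
      - (ε g h : K) • (TensorAlgebra.ι K y * TensorAlgebra.ι K x)
      - TensorAlgebra.ι K (A.bracket x y)}

/-- The two-sided ideal of the tensor algebra defining the universal enveloping algebra. -/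
def envelopingIdeal (A : ColorLieAlgebra K G L ε) : TwoSidedIdeal (TensorAlgebra K L) :=
  TwoSidedIdeal.span A.relators

/-- The universal enveloping algebra of a color Lie algebra: the quotient of the tensor algebra
by the two-sided ideal generated by the relators. -/
abbrev Enveloping (A : ColorLieAlgebra K G L ε) : Type _ :=
  A.envelopingIdeal.ringCon.Quotient

end ColorLieAlgebra

/-! This is a Gröbner-type argument, for which the words need not be linearly independent. A
homogeneous basis of `L` generates the enveloping algebra and commutes up to nonzero scalars and
linear terms. Hence permuting a word rescales it modulo words of smaller exponent
(`QuasiCommuting.word_perm`). Leading exponents of a left ideal form an upper set, and nested left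
ideals with the same leading exponents coincide (`QuasiCommuting.le_of_leadingContents_subset`).
Dickson's lemma then stops ascending chains. The right-hand case is the same argument in the
opposite algebra. -/

section QuasiCommuting

/-! ### Words in quasi-commuting generators -/

variable {K B σ : Type*} [Field K] [Ring B] [Algebra K B] [LinearOrder σ]

/-- The exponent vector of a word, ordered by degree and then lexicographically. -/
noncomputable def wordContent (l : List σ) : DegLex (σ →₀ ℕ) :=
  toDegLex (Multiset.toFinsupp (l : Multiset σ))

theorem wordContent_append (l₁ l₂ : List σ) :
    wordContent (l₁ ++ l₂) = wordContent l₁ + wordContent l₂ := by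
  simp only [wordContent, ← Multiset.coe_add, map_add, toDegLex_add]

theorem wordContent_cons (i : σ) (l : List σ) :
    wordContent (i :: l) = wordContent [i] + wordContent l :=
  wordContent_append [i] l

theorem wordContent_eq_of_perm {l₁ l₂ : List σ} (h : l₁.Perm l₂) :
    wordContent l₁ = wordContent l₂ := by
  rw [wordContent, Multiset.coe_eq_coe.2 h, wordContent]

theorem perm_of_wordContent_eq {l₁ l₂ : List σ} (h : wordContent l₁ = wordContent l₂) :
    l₁.Perm l₂ :=
  Multiset.coe_eq_coe.1 (Multiset.toFinsupp.injective (toDegLex_injective h))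

theorem degree_wordContent (l : List σ) : (ofDegLex (wordContent l)).degree = l.length := by
  induction l with
  | nil => simp [wordContent]
  | cons i l ih =>
    rw [wordContent_cons, ofDegLex_add, map_add, ih]
    simp [wordContent, add_comm]

theorem wordContent_lt_of_length_lt {l₁ l₂ : List σ} (h : l₁.length < l₂.length) :
    wordContent l₁ < wordContent l₂ := by
  rw [Finsupp.DegLex.lt_iff, degree_wordContent, degree_wordContent]
  exact Or.inl h

theorem exists_wordContent_eq (a : DegLex (σ →₀ ℕ)) : ∃ l : List σ, wordContent l = a := by
  refine ⟨(Finsupp.toMultiset (ofDegLex a)).toList, ?_⟩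
  simp [wordContent]

/-- The span of the words in `x` whose exponent vector is smaller than `a`. -/
def lowerWords (K : Type*) [Field K] [Algebra K B] (x : σ → B) (a : DegLex (σ →₀ ℕ)) :
    Submodule K B :=
  Submodule.span K {w | ∃ l : List σ, wordContent l < a ∧ w = (l.map x).prod}

variable {x : σ → B}

theorem word_mem_lowerWords {l : List σ} {a : DegLex (σ →₀ ℕ)} (h : wordContent l < a) :
    (l.map x).prod ∈ lowerWords K x a :=
  Submodule.subset_span ⟨l, h, rfl⟩

theorem lowerWords_mono {a b : DegLex (σ →₀ ℕ)} (h : a ≤ b) :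
    lowerWords K x a ≤ lowerWords K x b :=
  Submodule.span_mono fun _ ⟨l, hl, hw⟩ => ⟨l, hl.trans_le h, hw⟩

theorem word_mul_mem_lowerWords (l : List σ) {a : DegLex (σ →₀ ℕ)} {f : B}
    (hf : f ∈ lowerWords K x a) :
    (l.map x).prod * f ∈ lowerWords K x (wordContent l + a) := by
  induction hf using Submodule.span_induction with
  | mem w hw =>
    obtain ⟨l', hl', rfl⟩ := hw
    rw [← List.prod_append, ← List.map_append]
    refine word_mem_lowerWords ?_
    rw [wordContent_append]
    exact add_lt_add_right hl' _
  | zero => simp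
  | add f g _ _ hf hg => rw [mul_add]; exact add_mem hf hg
  | smul c f _ hf => rw [mul_smul_comm]; exact Submodule.smul_mem _ _ hf

/-- The generators commute up to nonzero scalars and linear terms. -/
def QuasiCommuting (K : Type*) [Field K] [Algebra K B] (x : σ → B) : Prop :=
  ∀ i j, ∃ q : K, q ≠ 0 ∧ x i * x j - q • (x j * x i) ∈ Submodule.span K (Set.range x)

/-- An adjacent swap costs a linear term in place of two letters, so the error has smaller length;
this is why degree is compared first. -/
theorem QuasiCommuting.word_perm (hx : QuasiCommuting K x) {l₁ l₂ : List σ} (h : l₁.Perm l₂) :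
    ∃ c : K, c ≠ 0 ∧
      (l₁.map x).prod - c • (l₂.map x).prod ∈ lowerWords K x (wordContent l₁) := by
  induction h with
  | nil => exact ⟨1, one_ne_zero, by simp⟩
  | cons i _ ih =>
    obtain ⟨c, hc, h⟩ := ih
    refine ⟨c, hc, ?_⟩
    have := word_mul_mem_lowerWords [i] h
    rw [← wordContent_cons] at this
    simpa [mul_sub] using this
  | swap i j l =>
    obtain ⟨q, hq, h⟩ := hx j i
    refine ⟨q, hq, ?_⟩
    have key : ∀ f ∈ Submodule.span K (Set.range x),
        f * (l.map x).prod ∈ lowerWords K x (wordContent (j :: i :: l)) := by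
      intro f hf
      induction hf using Submodule.span_induction with
      | mem w hw =>
        obtain ⟨k, rfl⟩ := hw
        rw [← List.prod_cons, ← List.map_cons]
        exact word_mem_lowerWords (wordContent_lt_of_length_lt (by simp))
      | zero => simp
      | add f g _ _ hf hg => rw [add_mul]; exact add_mem hf hg
      | smul c f _ hf => rw [smul_mul_assoc]; exact Submodule.smul_mem _ _ hf
    simpa [sub_mul, mul_assoc] using key _ h
  | trans h₁ _ ih₁ ih₂ =>
    obtain ⟨c, hc, h⟩ := ih₁
    obtain ⟨d, hd, h'⟩ := ih₂
    rw [← wordContent_eq_of_perm h₁] at h'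
    refine ⟨c * d, mul_ne_zero hc hd, ?_⟩
    have := add_mem h (Submodule.smul_mem _ c h')
    simpa [smul_sub, mul_smul] using this

/-! ### Leading exponents of left ideals -/

/-- The exponent vectors of the leading words of elements of `I`. -/
def leadingContents (K : Type*) [Field K] [Algebra K B] (x : σ → B) (I : Submodule B B) :
    Set (σ →₀ ℕ) :=
  {a | ∃ l : List σ, wordContent l = toDegLex a ∧
    ∃ f ∈ I, f - (l.map x).prod ∈ lowerWords K x (toDegLex a)}

theorem leadingContents_mono {I J : Submodule B B} (h : I ≤ J) :
    leadingContents K x I ⊆ leadingContents K x J :=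
  fun _ ⟨l, hl, f, hf, hfl⟩ => ⟨l, hl, f, h hf, hfl⟩

theorem isUpperSet_leadingContents (I : Submodule B B) :
    IsUpperSet (leadingContents K x I) := by
  rintro a b hab ⟨l, hl, f, hf, hfl⟩
  obtain ⟨c, rfl⟩ := le_iff_exists_add'.1 hab
  obtain ⟨l', hl'⟩ := exists_wordContent_eq (toDegLex c)
  refine ⟨l' ++ l, by rw [wordContent_append, hl, hl', toDegLex_add], (l'.map x).prod * f,
    I.smul_mem _ hf, ?_⟩
  have := word_mul_mem_lowerWords l' hfl
  rwa [hl', mul_sub, ← List.prod_append, ← List.map_append, ← toDegLex_add] at this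

theorem QuasiCommuting.exists_sub_mem_lowerWords (hx : QuasiCommuting K x)
    {I : Submodule B B} {l : List σ} (h : ofDegLex (wordContent l) ∈ leadingContents K x I) :
    ∃ f ∈ I, f - (l.map x).prod ∈ lowerWords K x (wordContent l) := by
  obtain ⟨l', hl', f, hf, hfl⟩ := h
  rw [toDegLex_ofDegLex] at hl' hfl
  obtain ⟨c, hc, h⟩ := hx.word_perm (perm_of_wordContent_eq hl')
  rw [hl'] at h
  refine ⟨c⁻¹ • f, I.smul_of_tower_mem _ hf, ?_⟩
  have := Submodule.smul_mem _ c⁻¹ (add_mem hfl h)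
  simpa [smul_sub, smul_smul, hc] using this

/-- An element of `lowerWords K x a` is a multiple of a word, up to smaller words. -/
theorem QuasiCommuting.exists_leading_word (hx : QuasiCommuting K x)
    {a : DegLex (σ →₀ ℕ)} {f : B} (hf : f ∈ lowerWords K x a) :
    f = 0 ∨ ∃ l : List σ, wordContent l < a ∧ ∃ c : K,
      f - c • (l.map x).prod ∈ lowerWords K x (wordContent l) := by
  induction hf using Submodule.span_induction with
  | mem w hw =>
    obtain ⟨l, hl, rfl⟩ := hw
    exact Or.inr ⟨l, hl, 1, by simp⟩
  | zero => exact Or.inl rfl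
  | smul d f _ hf =>
    obtain rfl | ⟨l, hl, c, h⟩ := hf
    · exact Or.inl (smul_zero d)
    · refine Or.inr ⟨l, hl, d * c, ?_⟩
      rw [mul_smul, ← smul_sub]
      exact Submodule.smul_mem _ _ h
  | add f g _ _ hf hg =>
    obtain rfl | ⟨l, hl, c, h⟩ := hf
    · rwa [zero_add]
    obtain rfl | ⟨l', hl', c', h'⟩ := hg
    · rw [add_zero]
      exact Or.inr ⟨l, hl, c, h⟩
    have aux : ∀ {m m' : List σ} {p p' : B} {d d' : K}, wordContent m < wordContent m' →
        p - d • (m.map x).prod ∈ lowerWords K x (wordContent m) →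
        p' - d' • (m'.map x).prod ∈ lowerWords K x (wordContent m') →
        p + p' - d' • (m'.map x).prod ∈ lowerWords K x (wordContent m') := by
      intro m m' p p' d d' hlt h h'
      have h₁ := lowerWords_mono hlt.le h
      have h₂ := Submodule.smul_mem _ d (word_mem_lowerWords (K := K) (x := x) hlt)
      have := add_mem (add_mem h₁ h₂) h'
      rwa [sub_add_cancel, ← add_sub_assoc] at this
    rcases lt_trichotomy (wordContent l) (wordContent l') with hlt | heq | hlt
    · exact Or.inr ⟨l', hl', c', aux hlt h h'⟩
    · obtain ⟨d, hd, hp⟩ := hx.word_perm (perm_of_wordContent_eq heq)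
      rw [heq] at h hp
      -- Leading terms may cancel here, so the coefficient is not required to be nonzero.
      refine Or.inr ⟨l', hl', c * d + c', ?_⟩
      have := add_mem (add_mem h (Submodule.smul_mem _ c hp)) h'
      convert this using 1
      simp only [smul_sub, add_smul, mul_smul]
      abel
    · refine Or.inr ⟨l, hl, c, ?_⟩
      rw [add_comm f g]
      exact aux hlt h' h

theorem exists_mem_lowerWords (hspan : Algebra.adjoin K (Set.range x) = ⊤) (f : B)
    [Nonempty σ] : ∃ a, f ∈ lowerWords K x a := by
  have hf : f ∈ Submodule.span K (Submonoid.closure (Set.range x) : Set B) := by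
    rw [← Algebra.adjoin_eq_span, hspan]
    trivial
  induction hf using Submodule.span_induction with
  | mem w hw =>
    rw [← Set.image_univ] at hw
    obtain ⟨l, hl, rfl⟩ := Submonoid.exists_list_of_mem_closure hw
    obtain ⟨m, rfl⟩ : ∃ m : List σ, m.map x = l := by
      have : l ∈ Set.range (List.map x) := by
        rw [Set.range_list_map]
        intro b hb
        simpa using hl b hb
      exact this
    obtain ⟨i⟩ := ‹Nonempty σ›
    -- The bound is strict, so an extra letter is needed to exceed `m`.
    exact ⟨wordContent (i :: m), word_mem_lowerWords (wordContent_lt_of_length_lt (by simp))⟩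
  | zero => exact ⟨0, zero_mem _⟩
  | add f g _ _ hf hg =>
    obtain ⟨a, ha⟩ := hf
    obtain ⟨b, hb⟩ := hg
    exact ⟨max a b, add_mem (lowerWords_mono (le_max_left a b) ha)
      (lowerWords_mono (le_max_right a b) hb)⟩
  | smul c f _ hf =>
    obtain ⟨a, ha⟩ := hf
    exact ⟨a, Submodule.smul_mem _ _ ha⟩

/-- Division algorithm: subtracting an element of `I` with the same leading term lowers the exponent
bound, and the degree-lexicographic order is well-founded. -/
theorem QuasiCommuting.le_of_leadingContents_subset [Finite σ] [Nonempty σ]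
    (hx : QuasiCommuting K x) (hspan : Algebra.adjoin K (Set.range x) = ⊤)
    {I J : Submodule B B} (hIJ : I ≤ J)
    (h : leadingContents K x J ⊆ leadingContents K x I) : J ≤ I := by
  intro f hf
  obtain ⟨a, ha⟩ := exists_mem_lowerWords hspan f
  induction a using WellFoundedLT.induction generalizing f with
  | ind a ih =>
    obtain rfl | ⟨l, hl, c, hc⟩ := hx.exists_leading_word ha
    · exact zero_mem _
    by_cases hc0 : c = 0
    · exact ih _ hl hf (by simpa [hc0] using hc)
    · have hJ : ofDegLex (wordContent l) ∈ leadingContents K x J := by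
        refine ⟨l, rfl, c⁻¹ • f, J.smul_of_tower_mem _ hf, ?_⟩
        have := Submodule.smul_mem _ c⁻¹ hc
        simpa [smul_sub, smul_smul, hc0] using this
      obtain ⟨g, hg, hgl⟩ := hx.exists_sub_mem_lowerWords (h hJ)
      have hcg : c • g ∈ I := I.smul_of_tower_mem _ hg
      have hlow : f - c • g ∈ lowerWords K x (wordContent l) := by
        have := sub_mem hc (Submodule.smul_mem _ c hgl)
        simpa [smul_sub] using this
      have := add_mem (ih _ hl (sub_mem hf (hIJ hcg)) hlow) hcg
      rwa [sub_add_cancel] at this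

/-- An algebra with finitely many generators commuting up to nonzero scalars and linear terms is
left noetherian. -/
theorem QuasiCommuting.isNoetherianRing [Finite σ]
    (hx : QuasiCommuting K x) (hspan : Algebra.adjoin K (Set.range x) = ⊤) :
    IsNoetherianRing B := by
  cases isEmpty_or_nonempty σ
  · rw [Set.range_eq_empty, Algebra.adjoin_empty] at hspan
    exact isNoetherianRing_of_surjective K B (algebraMap K B)
      (Algebra.surjective_algebraMap_iff.2 hspan.symm)
  rw [isNoetherianRing_iff, isNoetherian_iff, RelEmbedding.wellFounded_iff_isEmpty]
  refine ⟨fun I => ?_⟩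
  have hI : StrictMono I := fun m n hmn => I.map_rel_iff.2 hmn
  have hnew : ∀ n, ∃ a ∈ leadingContents K x (I (n + 1)), a ∉ leadingContents K x (I n) := by
    intro n
    have hlt : I n < I (n + 1) := hI n.lt_succ_self
    by_contra! h
    exact hlt.not_ge (hx.le_of_leadingContents_subset hspan hlt.le h)
  choose a ha hna using hnew
  -- Dickson's lemma: some new exponent dominates an earlier one, so it was not new.
  obtain ⟨m, n, hmn, hle⟩ := wellQuasiOrdered_le a
  exact hna n (isUpperSet_leadingContents _ hle
    (leadingContents_mono (hI.monotone (Nat.succ_le_of_lt hmn)) (ha m)))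

end QuasiCommuting

/-! ### Passage to the opposite algebra -/

section Opposite

variable {K B σ : Type*} [Field K] [Ring B] [Algebra K B] {x : σ → B}

theorem QuasiCommuting.op (hx : QuasiCommuting K x) :
    QuasiCommuting K fun i => MulOpposite.op (x i) := by
  intro i j
  obtain ⟨q, hq, h⟩ := hx j i
  refine ⟨q, hq, ?_⟩
  have := Submodule.mem_map_of_mem (f := (MulOpposite.opLinearEquiv K : B ≃ₗ[K] Bᵐᵒᵖ).toLinearMap) h
  rw [Submodule.map_span, ← Set.range_comp] at this
  simpa using! this

theorem adjoin_range_op_eq_top (hspan : Algebra.adjoin K (Set.range x) = ⊤) :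
    Algebra.adjoin K (Set.range fun i => MulOpposite.op (x i)) = ⊤ := by
  have hrange : (Set.range fun i => MulOpposite.op (x i)) = MulOpposite.unop ⁻¹' Set.range x := by
    ext b
    simp [← MulOpposite.unop_inj]
  rw [hrange, ← Subalgebra.op_adjoin, hspan, Subalgebra.op_top]

end Opposite

/-! ### Generators of the enveloping algebra -/

namespace ColorLieAlgebra

variable {K G L : Type*} [Field K] [CommGroup G] [AddCommGroup L] [Module K L]
  {ε : G → G → Kˣ} (A : ColorLieAlgebra K G L ε)

/-- The canonical map from a color Lie algebra to its enveloping algebra. -/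
def toEnveloping : L →ₗ[K] A.Enveloping :=
  (A.envelopingIdeal.ringCon.mkₐ K).toLinearMap ∘ₗ TensorAlgebra.ι K

theorem adjoin_range_toEnveloping :
    Algebra.adjoin K (Set.range A.toEnveloping) = ⊤ := by
  have : Set.range A.toEnveloping =
      A.envelopingIdeal.ringCon.mkₐ K '' Set.range (TensorAlgebra.ι K) := by
    rw [← Set.range_comp]
    rfl
  rw [this, ← AlgHom.map_adjoin, TensorAlgebra.adjoin_range_ι, Algebra.map_top,
    AlgHom.range_eq_top]
  exact A.envelopingIdeal.ringCon.mk'_surjective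

theorem toEnveloping_mul_sub {g h : G} {x y : L} (hx : x ∈ A.component g)
    (hy : y ∈ A.component h) :
    A.toEnveloping x * A.toEnveloping y - (ε g h : K) • (A.toEnveloping y * A.toEnveloping x) =
      A.toEnveloping (A.bracket x y) := by
  have hmem : TensorAlgebra.ι K x * TensorAlgebra.ι K y
      - (ε g h : K) • (TensorAlgebra.ι K y * TensorAlgebra.ι K x)
      - TensorAlgebra.ι K (A.bracket x y) ∈ A.envelopingIdeal :=
    TwoSidedIdeal.subset_span ⟨g, h, x, y, hx, hy, rfl⟩
  have := (RingCon.eq A.envelopingIdeal.ringCon).2 ((TwoSidedIdeal.mem_iff _ _).1 hmem)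
  exact sub_eq_zero.1 this

theorem exists_homogeneous_basis [FiniteDimensional K L] :
    ∃ (n : ℕ) (b : Module.Basis (Fin n) K L), ∀ i, ∃ g, b i ∈ A.component g := by
  classical
  let b := A.isInternal.collectedBasis fun g => Module.Basis.ofVectorSpace K (A.component g)
  have := Module.Finite.finite_basis b
  obtain ⟨n, ⟨e⟩⟩ := Finite.exists_equiv_fin (Σ g, Module.Basis.ofVectorSpaceIndex K (A.component g))
  refine ⟨n, b.reindex e, fun i => ⟨(e.symm i).1, ?_⟩⟩
  rw [Module.Basis.reindex_apply]
  exact A.isInternal.collectedBasis_mem _ _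

variable {σ : Type*} (b : Module.Basis σ K L)

theorem span_range_toEnveloping_basis :
    Submodule.span K (Set.range (A.toEnveloping ∘ b)) = A.toEnveloping.range := by
  rw [Set.range_comp, ← Submodule.map_span, b.span_eq, LinearMap.range_eq_map]

theorem adjoin_range_toEnveloping_basis :
    Algebra.adjoin K (Set.range (A.toEnveloping ∘ b)) = ⊤ := by
  rw [← Algebra.adjoin_span, A.span_range_toEnveloping_basis b]
  exact A.adjoin_range_toEnveloping

theorem quasiCommuting_toEnveloping_basis (hb : ∀ i, ∃ g, b i ∈ A.component g) :
    QuasiCommuting K (A.toEnveloping ∘ b) := by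
  intro i j
  obtain ⟨g, hg⟩ := hb i
  obtain ⟨h, hh⟩ := hb j
  refine ⟨ε g h, (ε g h).ne_zero, ?_⟩
  rw [A.span_range_toEnveloping_basis b]
  exact ⟨A.bracket (b i) (b j), (A.toEnveloping_mul_sub hg hh).symm⟩

end ColorLieAlgebra

/-- The universal enveloping algebra of a finite-dimensional color Lie algebra over a field of
characteristic zero is left and right noetherian. -/
theorem corollary2p6 {K G L : Type*} [Field K] [CharZero K] [CommGroup G]
    [AddCommGroup L] [Module K L] [FiniteDimensional K L]
    (ε : G → G → Kˣ) (hε : IsAntisymmBicharacter ε) (A : ColorLieAlgebra K G L ε) :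
    IsNoetherianRing A.Enveloping ∧ IsNoetherianRing (A.Enveloping)ᵐᵒᵖ := by
  obtain ⟨n, b, hb⟩ := A.exists_homogeneous_basis
  have hq := A.quasiCommuting_toEnveloping_basis b hb
  have hspan := A.adjoin_range_toEnveloping_basis b
  exact ⟨hq.isNoetherianRing hspan, hq.op.isNoetherianRing (adjoin_range_op_eq_top hspan)⟩
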